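/- Let $\alpha,\beta,\gamma>0$, let $D\subset\mathbb{R}^d$ be measurable with finite Lebesgue measure, $U=L^2(D;\mathbb{R}^2)$, and let $$g(v)=\tfrac{\alpha}{2}(v_1^2+v_2^2)+\beta\,|v_1v_2|_0\quad(v\in\mathbb{R}^2),\qquad |t|_0=\begin{cases}1,&t\neq0,\\0,&t=0,\end{cases}$$ with Fenchel conjugate $g^*(q)=\sup_{v}\,(v\cdot q-g(v))$. Let $$h_\gamma(q)=\tfrac1\gamma\bigl(q-\mathrm{prox}_{\gamma g^*}(q)\bigr),\qquad \mathrm{prox}_{\gamma g^*}(q)=\arg\min_{w}\; g^*(w)+\tfrac1{2\gamma}|w-q|^2,$$ be the Moreau--Yosida regularization of $\partial g^*$. Let $V$ be a Banach space with a continuous embedding $V\hookrightarrow L^r(D;\mathbb{R}^2)$ for some $r\in(2,\infty]$, let $Y$ be a real Hilbert space, $z\in Y$, and let $S:U\to Y$ be a bounded linear operator whose adjoint $S^*:Y\to U$ maps continuously into $V$. For $p\in V$ let $[H_\gamma(p)](x)=h_\gamma(p(x))$, and for $p,\delta p\in V$ let $[D_NH_\gamma(p)\delta p](x)=M_p(x)\,\delta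 p(x)$, where for each $p\in V$ the map $x\mapsto M_p(x)$ is some measurable selection of $x\mapsto\partial_C h_\gamma(p(x))$; here $\partial_C h_\gamma(q)$ is the Clarke derivative of $h_\gamma$ at $q$, i.e., the convex hull of all limits of $h_\gamma'(q_k)$ along sequences $q_k\to q$ of points at which $h_\gamma$ is differentiable. Consider the reduced regularized optimality system $$y=SH_\gamma(p),\qquad p=-S^*(y-z),\qquad (y,p)\in Y\times V, \tag{1}$$ and the semismooth Newton iteration $(y^{k+1},p^{k+1})=(y^k,p^k)+(\delta y,\delta p)$, where $(\delta y,\delta p)\in Y\times V$ solves $$\delta y-SD_NH_\gamma(p^k)\delta p=-y^k+SH_\gamma(p^k),\qquad \delta p+S^*\delta y=-p^k-S^*(y^k-z). \tag{2}$$ Then: 1. $H_\gamma(p)\in U$ and $D_NH_\gamma(p)\delta p\in U$ for all $p,\delta p\in V$, and $H_\gamma:V\to U$ is Newton differentiable with Newton derivative $D_NH_\gamma$: for every $p\in V$, $$\|H_\gamma(p+\delta p)-H_\gamma(p)-D_NH_\gamma(p+\delta p)\delta p\|_U=o(\|\delta p\|_V)\quad\text{as }\|\delta p\|_V\to0.$$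 2. There is a constant $C$ such that for all $p\in V$ and $(w_1,w_2)\in Y\times V$ the system $\delta y-SD_NH_\gamma(p)\delta p=w_1$, $\delta p+S^*\delta y=w_2$ has a unique solution $(\delta y,\delta p)\in Y\times V$, and $\|\delta y\|_Y+\|\delta p\|_V\le C(\|w_1\|_Y+\|w_2\|_V)$. In particular, every Newton step (2) is well defined and unique. 3. System (1) has a solution, and the Newton iteration converges locally superlinearly in $Y\times V$: for every solution $(\bar y,\bar p)$ of (1) there is $\varepsilon>0$ such that, whenever $(y^0,p^0)$ lies within distance $\varepsilon$ of $(\bar y,\bar p)$ in $Y\times V$, the iterates satisfy $(y^k,p^k)\to(\bar y,\bar p)$ in $Y\times V$ and $$\|(y^{k+1},p^{k+1})-(\bar y,\bar p)\|_{Y\times V}=o\bigl(\|(y^k,p^k)-(\bar y,\bar p)\|_{Y\times V}\bigr)\quad\text{as }k\to\infty.$$ -/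

import Mathlib

open MeasureTheory Filter Topology Asymptotics
open scoped ENNReal

noncomputable section

namespace SwitchingControl

/-- The control space `ℝ²` with the Euclidean norm. -/
abbrev Plane := EuclideanSpace ℝ (Fin 2)

/-- The binary function `|t|₀`. -/
def absZero (t : ℝ) : ℝ := if t = 0 then 0 else 1

/-- The pointwise switching cost `g(v) = α/2 (v₁² + v₂²) + β |v₁ v₂|₀`. -/
def cost (α β : ℝ) (v : Plane) : ℝ :=
  α / 2 * (v 0 ^ 2 + v 1 ^ 2) + β * absZero (v 0 * v 1)

/-- The Fenchel conjugate `f*(q) = sup_v (v · q - f(v))` of a function on `ℝ²` whose conjugate is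
finite, as is the case for `cost α β` with `0 < α` and `0 ≤ β`. -/
def conjugate (f : Plane → ℝ) (q : Plane) : ℝ := ⨆ v : Plane, (inner ℝ v q - f v)

/-- The proximal mapping `prox_{γ f}(v) = argmin_w f(w) + ‖w - v‖² / (2γ)`. For `0 < γ` and a finite
convex `f` the minimizer exists and is unique. -/
def prox (γ : ℝ) (f : Plane → ℝ) (v : Plane) : Plane :=
  Classical.epsilon fun w : Plane =>
    ∀ w' : Plane, f w + 1 / (2 * γ) * ‖w - v‖ ^ 2 ≤ f w' + 1 / (2 * γ) * ‖w' - v‖ ^ 2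

/-- The Moreau-Yosida regularization `h_γ = (∂g*)_γ = (Id - prox_{γ g*}) / γ`. -/
def hReg (α β γ : ℝ) (q : Plane) : Plane :=
  (1 / γ) • (q - prox γ (conjugate (cost α β)) q)

/-- The Clarke generalized derivative of `f` at `q`: the convex hull of all limits of derivatives
`f'(q_k)` along sequences `q_k → q` of points of differentiability of `f`. -/
def clarkeDeriv (f : Plane → Plane) (q : Plane) : Set (Plane →L[ℝ] Plane) :=
  convexHull ℝ {A | ∃ s : ℕ → Plane, (∀ k, DifferentiableAt ℝ f (s k)) ∧
    Tendsto s atTop (𝓝 q) ∧ Tendsto (fun k => fderiv ℝ f (s k)) atTop (𝓝 A)}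

section Operators

variable {X : Type*} [MeasurableSpace X] {μ : Measure X} {r : ℝ≥0∞} [Fact (1 ≤ r)]
  {V : Type*} [NormedAddCommGroup V] [NormedSpace ℝ V]
  {Y : Type*} [NormedAddCommGroup Y] [InnerProductSpace ℝ Y]

/-- The element of `L²(μ; ℝ²)` represented by a square integrable function `f`
(and `0` if `f` is not square integrable). -/
def toL2 (μ : Measure X) (f : X → Plane) : Lp Plane 2 μ :=
  open Classical in if hf : MemLp f 2 μ then hf.toLp f else 0

/-- The superposition operator `H : V → L²`, `[H(p)](x) = h(p(x))`, where `ι` is the embedding of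
`V` into `L^r`. -/
def superposition (h : Plane → Plane) (ι : V →L[ℝ] Lp Plane r μ) (p : V) : Lp Plane 2 μ :=
  toL2 μ fun x => h (ι p x)

/-- `M` assigns to every `p ∈ V` a measurable selection `x ↦ M p x` of `x ↦ ∂_C h(p(x))`. -/
def IsClarkeSelection (h : Plane → Plane) (ι : V →L[ℝ] Lp Plane r μ)
    (M : V → X → (Plane →L[ℝ] Plane)) : Prop :=
  ∀ p : V, AEStronglyMeasurable (M p) μ ∧ ∀ᵐ x ∂μ, M p x ∈ clarkeDeriv h (ι p x)

/-- The Newton derivative `D_N H(p) : V → L²`, `[D_N H(p) δp](x) = M p x (δp(x))`. -/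
def newtonDeriv (ι : V →L[ℝ] Lp Plane r μ) (M : V → X → (Plane →L[ℝ] Plane)) (p δp : V) :
    Lp Plane 2 μ :=
  toL2 μ fun x => M p x (ι δp x)

/-- `(y, p)` solves the reduced regularized optimality system `y = S H(p)`, `p = -S*(y - z)`.
Here `T` is the adjoint `S*` as a map into `V`. -/
def IsSolution (h : Plane → Plane) (ι : V →L[ℝ] Lp Plane r μ) (S : Lp Plane 2 μ →L[ℝ] Y)
    (T : Y →L[ℝ] V) (z : Y) (x : Y × V) : Prop :=
  x.1 = S (superposition h ι x.2) ∧ x.2 = -T (x.1 - z)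

/-- The linear Newton system `δy - S D_N H(p) δp = w₁`, `δp + S* δy = w₂` for `δ = (δy, δp)`. -/
def NewtonSystem (ι : V →L[ℝ] Lp Plane r μ) (M : V → X → (Plane →L[ℝ] Plane))
    (S : Lp Plane 2 μ →L[ℝ] Y) (T : Y →L[ℝ] V) (p : V) (δ w : Y × V) : Prop :=
  δ.1 - S (newtonDeriv ι M p δ.2) = w.1 ∧ δ.2 + T δ.1 = w.2

/-- `x'` is obtained from `x = (y, p)` by one semismooth Newton step. -/
def IsNewtonStep (h : Plane → Plane) (ι : V →L[ℝ] Lp Plane r μ)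
    (M : V → X → (Plane →L[ℝ] Plane)) (S : Lp Plane 2 μ →L[ℝ] Y) (T : Y →L[ℝ] V) (z : Y)
    (x x' : Y × V) : Prop :=
  ∃ δ : Y × V, NewtonSystem ι M S T x.2 δ
      (-x.1 + S (superposition h ι x.2), -x.2 - T (x.1 - z)) ∧ x' = x + δ

end Operators

end SwitchingControl

end

open MeasureTheory Filter Topology Asymptotics
open scoped ENNReal

noncomputable section

namespace SwitchingControl

/-! The conjugate $g^*$ is the maximum of the convex quadratics $q_1^2/2\alpha$, $q_2^2/2\alpha$ and
$|q|^2/2\alpha-\beta$ (`conjugate_cost`). Stationarity of the proximal point then leaves finitely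
many affine formulas for each of its coordinates (`prox_coord_mem`), and convexity makes $h_\gamma$
monotone and $1/\gamma$-Lipschitz (`hReg_cocoercive`). So $h_\gamma$ is a continuous selection of
finitely many affine maps. Maps active at points near $q$ are already active at $q$, so
$h_\gamma(q')-h_\gamma(q)=B(q'-q)$ holds without remainder for $q'$ near $q$ and every Clarke
derivative $B$ at $q'$ (`IsAffineSelection.eventually_clarkeDeriv`).

For the superposition operator, the linearization residual therefore lives on the set where the
radius of exactness at $p(x)$ is small or $\delta p(x)$ is large. Its measure can be made small, and
Hölder's inequality with $r>2$ turns this into $o(\|\delta p\|_V)$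
(`superposition_newtonDifferentiable`).

Eliminating $p$ or $\delta p$ leaves an equation on $Y$ for the identity plus a monotone Lipschitz
map, the monotonicity coming from that of $h_\gamma$ and from $S$ and $S^*$ being adjoint.
Zarantonello's theorem solves it, with strong monotonicity constant 1 whatever $p$ is
(`exists_isSolution`, `newtonSystem_solvable`). Uniform invertibility and Newton differentiability
together give superlinear convergence (`newton_superlinear`). -/

/-! ### The Fenchel conjugate of the switching cost -/

/-- The maximum of the three quadratics that make up the conjugate of the switching cost, in terms
of the squares `x`, `y` of the coordinates. -/
def conjSq (α β x y : ℝ) : ℝ := max (max (x / (2 * α)) (y / (2 * α))) ((x + y) / (2 * α) - β)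

lemma conjSq_comm (α β x y : ℝ) : conjSq α β x y = conjSq α β y x := by
  simp only [conjSq, max_comm (x / (2 * α)), add_comm x y]

lemma conjSq_of_le {α β x y : ℝ} (hα : 0 < α) (hyx : y ≤ x) (hy : y ≤ 2 * α * β) :
    conjSq α β x y = x / (2 * α) := by
  have h1 : y / (2 * α) ≤ x / (2 * α) := by gcongr
  have h2 : y / (2 * α) ≤ β := by rw [div_le_iff₀ (by positivity)]; linarith
  rw [conjSq, max_eq_left h1, max_eq_left]
  rw [add_div]; linarith

lemma conjSq_of_ge {α β x y : ℝ} (hα : 0 < α) (hx : 2 * α * β ≤ x) (hy : 2 * α * β ≤ y) :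
    conjSq α β x y = (x + y) / (2 * α) - β := by
  have h1 : β ≤ x / (2 * α) := by rw [le_div_iff₀ (by positivity)]; linarith
  have h2 : β ≤ y / (2 * α) := by rw [le_div_iff₀ (by positivity)]; linarith
  rw [conjSq, max_eq_right]
  rw [add_div]; exact max_le (by linarith) (by linarith)

lemma plane_inner (v q : Plane) : inner ℝ v q = v 0 * q 0 + v 1 * q 1 := by
  simp [PiLp.inner_apply, Fin.sum_univ_two, mul_comm]

/-- The three quadratics correspond to $v_1\neq0=v_2$ (or $v=0$), $v_1=0\ne v_2$ and $v_1v_2\neq0$.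
Young's inequality bounds each branch, and $v_i=q_i/\alpha$ attains it. -/
lemma conjugate_cost {α β : ℝ} (hα : 0 < α) (hβ : 0 < β) (q : Plane) :
    conjugate (cost α β) q = conjSq α β (q 0 ^ 2) (q 1 ^ 2) := by
  have key : ∀ s t : ℝ, s * t - α / 2 * s ^ 2 ≤ t ^ 2 / (2 * α) := fun s t => by
    rw [le_div_iff₀ (by positivity)]; nlinarith [sq_nonneg (α * s - t)]
  have hub : ∀ v : Plane, inner ℝ v q - cost α β v ≤ conjSq α β (q 0 ^ 2) (q 1 ^ 2) := by
    intro v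
    rw [plane_inner, cost]
    have k0 := key (v 0) (q 0)
    have k1 := key (v 1) (q 1)
    by_cases h0 : v 0 = 0
    · refine le_trans ?_ ((le_max_right _ _).trans (le_max_left _ _))
      simp only [absZero, h0] at *; norm_num; linarith
    by_cases h1 : v 1 = 0
    · refine le_trans ?_ ((le_max_left _ _).trans (le_max_left _ _))
      simp only [absZero, h1] at *; norm_num; linarith
    · refine le_trans ?_ (le_max_right _ _)
      simp only [absZero, mul_eq_zero, h0, h1, or_self, if_false, add_div]; linarith
  have hbdd : BddAbove (Set.range fun v : Plane => inner ℝ v q - cost α β v) :=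
    ⟨_, by rintro _ ⟨v, rfl⟩; exact hub v⟩
  refine le_antisymm (ciSup_le hub) (max_le (max_le ?_ ?_) ?_)
  · refine le_trans (le_of_eq ?_) (le_ciSup hbdd !₂[q 0 / α, 0])
    simp [plane_inner, cost, absZero]; field_simp; ring
  · refine le_trans (le_of_eq ?_) (le_ciSup hbdd !₂[0, q 1 / α])
    simp [plane_inner, cost, absZero]; field_simp; ring
  -- If a coordinate of $q$ vanishes, this $v$ does not pay the penalty $\beta$, which only
  -- increases the value; hence an inequality here.
  · refine le_trans ?_ (le_ciSup hbdd !₂[q 0 / α, q 1 / α])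
    have : β * absZero (q 0 / α * (q 1 / α)) ≤ β := by
      unfold absZero; split_ifs <;> linarith
    simp only [plane_inner, cost, Matrix.cons_val_zero, Matrix.cons_val_one]
    have e : (q 0 ^ 2 + q 1 ^ 2) / (2 * α) = q 0 / α * q 0 + q 1 / α * q 1
        - α / 2 * ((q 0 / α) ^ 2 + (q 1 / α) ^ 2) := by field_simp; ring
    linarith

lemma conjugate_cost_of_ne {α β : ℝ} (hα : 0 < α) (hβ : 0 < β) {i j : Fin 2} (hij : i ≠ j)
    (q : Plane) : conjugate (cost α β) q = conjSq α β (q i ^ 2) (q j ^ 2) := by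
  rw [conjugate_cost hα hβ]
  fin_cases i <;> fin_cases j <;> first | exact absurd rfl hij | rfl | exact conjSq_comm _ _ _ _

lemma conjugate_cost_nonneg {α β : ℝ} (hα : 0 < α) (hβ : 0 < β) (q : Plane) :
    0 ≤ conjugate (cost α β) q := by
  rw [conjugate_cost hα hβ]
  exact le_trans (by positivity) ((le_max_left _ _).trans (le_max_left _ _))

lemma continuous_conjugate_cost {α β : ℝ} (hα : 0 < α) (hβ : 0 < β) :
    Continuous (conjugate (cost α β)) := by
  rw [funext (conjugate_cost hα hβ)]
  unfold conjSq
  fun_prop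

lemma convexOn_conjugate_cost {α β : ℝ} (hα : 0 < α) (hβ : 0 < β) :
    ConvexOn ℝ Set.univ (conjugate (cost α β)) := by
  have hq : ∀ i : Fin 2, ConvexOn ℝ Set.univ fun q : Plane => q i ^ 2 / (2 * α) := fun i => by
    refine ⟨convex_univ, fun x _ y _ a b ha hb hab => ?_⟩
    simp only [PiLp.add_apply, PiLp.smul_apply, smul_eq_mul, ← mul_div_assoc, ← add_div]
    gcongr
    exact even_two.convexOn_pow.2 trivial trivial ha hb hab
  have := ((hq 0).sup (hq 1)).sup (((hq 0).add (hq 1)).add_const (-β))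
  refine this.congr fun q _ => ?_
  rw [conjugate_cost hα hβ, conjSq, add_div, sub_eq_add_neg]
  rfl

/-! ### Optimality conditions for proximal points -/

section Prox

variable {f : Plane → ℝ} {γ : ℝ}

lemma prox_spec (hγ : 0 < γ) (hf : Continuous f) (hf0 : ∀ q, 0 ≤ f q) (q w' : Plane) :
    f (prox γ f q) + 1 / (2 * γ) * ‖prox γ f q - q‖ ^ 2 ≤ f w' + 1 / (2 * γ) * ‖w' - q‖ ^ 2 := by
  have hex : ∃ w : Plane, ∀ w' : Plane,
      f w + 1 / (2 * γ) * ‖w - q‖ ^ 2 ≤ f w' + 1 / (2 * γ) * ‖w' - q‖ ^ 2 := by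
    refine Continuous.exists_forall_le (by fun_prop) ?_
    have h1 : Tendsto (fun w : Plane => ‖w - q‖) (cocompact Plane) atTop := by
      simpa only [dist_eq_norm] using tendsto_dist_right_cocompact_atTop q
    have h2 := ((tendsto_pow_atTop two_ne_zero).comp h1).const_mul_atTop
      (show 0 < 1 / (2 * γ) by positivity)
    exact tendsto_atTop_mono (fun w => le_add_of_nonneg_left (hf0 w)) h2
  exact Classical.epsilon_spec hex w'

/-- Compare the minimizer with the points $w+t(w'-w)$ of a segment, bound $f$ there by convexity,
divide by $t$ and let $t\downarrow0$. -/
lemma prox_variational (hγ : 0 < γ) (hf : Continuous f) (hf0 : ∀ q, 0 ≤ f q)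
    (hc : ConvexOn ℝ Set.univ f) (q w' : Plane) :
    inner ℝ (q - prox γ f q) (w' - prox γ f q) ≤ γ * (f w' - f (prox γ f q)) := by
  have hmin := prox_spec hγ hf hf0 q
  set w := prox γ f q
  have key : ∀ t ∈ Set.Ioc (0 : ℝ) 1,
      inner ℝ (q - w) (w' - w) ≤ γ * (f w' - f w) + t * (‖w' - w‖ ^ 2 / 2) := by
    rintro t ⟨ht0, ht1⟩
    have h1 := hmin ((1 - t) • w + t • w')
    have h2 := hc.2 (Set.mem_univ w) (Set.mem_univ w') (sub_nonneg.2 ht1) ht0.le (by ring)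
    have h3 : (1 - t) • w + t • w' - q = (w - q) + t • (w' - w) := by module
    rw [h3, norm_add_sq_real, norm_smul, inner_smul_right, mul_pow, Real.norm_eq_abs, sq_abs] at h1
    have h4 : inner ℝ (q - w) (w' - w) = - inner ℝ (w - q) (w' - w) := by
      rw [← inner_neg_left, neg_sub]
    simp only [smul_eq_mul] at h2
    have h5 : 0 ≤ t * (f w' - f w)
        + 1 / (2 * γ) * (2 * (t * inner ℝ (w - q) (w' - w)) + t ^ 2 * ‖w' - w‖ ^ 2) := by linarith
    have h6 : t * (f w' - f w)
        + 1 / (2 * γ) * (2 * (t * inner ℝ (w - q) (w' - w)) + t ^ 2 * ‖w' - w‖ ^ 2)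
        = t / γ * (γ * (f w' - f w) + inner ℝ (w - q) (w' - w) + t * (‖w' - w‖ ^ 2 / 2)) := by
      field_simp; ring
    rw [h6] at h5
    have := nonneg_of_mul_nonneg_right h5 (by positivity)
    linarith
  have hlim : Tendsto (fun t : ℝ => γ * (f w' - f w) + t * (‖w' - w‖ ^ 2 / 2)) (𝓝[>] 0)
      (𝓝 (γ * (f w' - f w) + 0 * (‖w' - w‖ ^ 2 / 2))) :=
    (Continuous.tendsto (by fun_prop) 0).mono_left nhdsWithin_le_nhds
  rw [zero_mul, add_zero] at hlim
  refine ge_of_tendsto hlim ?_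
  filter_upwards [Ioc_mem_nhdsGT (zero_lt_one' ℝ)] with t ht using key t ht

/-- Along a line on which $f$ is locally quadratic, the proximal objective is a parabola with a
minimum at $0$, so its linear coefficient vanishes. Only the chosen direction matters, so this
applies even at a kink of $f$. -/
lemma prox_stationary (hγ : 0 < γ) (hf : Continuous f) (hf0 : ∀ q, 0 ≤ f q) (q d : Plane)
    {a b : ℝ} (hloc : ∀ᶠ t : ℝ in 𝓝 0,
      f (prox γ f q + t • d) = f (prox γ f q) + a * t + b * t ^ 2) :
    inner ℝ (q - prox γ f q) d = γ * a := by
  have hmin := prox_spec hγ hf hf0 q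
  set w := prox γ f q
  set A := a + 1 / γ * inner ℝ (w - q) d
  set B := b + 1 / (2 * γ) * ‖d‖ ^ 2
  have hm : IsLocalMin (fun t : ℝ => A * t + B * t ^ 2) 0 := by
    filter_upwards [hloc] with t ht
    have h1 := hmin (w + t • d)
    rw [ht, add_sub_right_comm, norm_add_sq_real, norm_smul, inner_smul_right, mul_pow,
      Real.norm_eq_abs, sq_abs] at h1
    have h2 : A * t + B * t ^ 2 = a * t + b * t ^ 2
        + 1 / (2 * γ) * (2 * (t * inner ℝ (w - q) d) + t ^ 2 * ‖d‖ ^ 2) := by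
      simp only [A, B]; field_simp; ring
    simp only [mul_zero, ne_eq, OfNat.ofNat_ne_zero, not_false_eq_true, zero_pow, add_zero]
    linarith
  have hd : HasDerivAt (fun t : ℝ => A * t + B * t ^ 2) A 0 := by
    have := ((hasDerivAt_id (0 : ℝ)).const_mul A).fun_add ((hasDerivAt_pow 2 (0 : ℝ)).const_mul B)
    simpa using this
  have h0 := hm.hasDerivAt_eq_zero hd
  have h4 : inner ℝ (q - w) d = - inner ℝ (w - q) d := by rw [← inner_neg_left, neg_sub]
  rw [h4]
  simp only [A] at h0
  field_simp at h0
  linarith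

end Prox

/-! ### The proximal map of the conjugate and its Moreau–Yosida regularization -/

/-- Each coordinate of the proximal point agrees with one of six affine functions. -/
lemma prox_coord_mem {α β γ : ℝ} (hα : 0 < α) (hβ : 0 < β) (hγ : 0 < γ) {i j : Fin 2}
    (hij : i ≠ j) (q : Plane) :
    prox γ (conjugate (cost α β)) q i ∈ ({(1 + γ / α)⁻¹ * q i, q i, √(2 * α * β),
      -√(2 * α * β), (2 + γ / α)⁻¹ * (q i + q j), (2 + γ / α)⁻¹ * (q i - q j)} : Set ℝ) := by
  have hst := fun d a b => prox_stationary (a := a) (b := b) hγ (continuous_conjugate_cost hα hβ)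
    (conjugate_cost_nonneg hα hβ) q d
  set w := prox γ (conjugate (cost α β)) q
  set c := 2 * α * β with hc
  have hG := conjugate_cost_of_ne hα hβ hij
  have hinner : ∀ s t : ℝ, inner ℝ (q - w) (EuclideanSpace.single i s + EuclideanSpace.single j t)
      = s * (q i - w i) + t * (q j - w j) := fun s t => by
    simp [inner_add_right, EuclideanSpace.inner_single_right]
  have hwi : ∀ s t u : ℝ, (w + u • (EuclideanSpace.single i s + EuclideanSpace.single j t)) i
      = w i + u * s := fun s t u => by simp [hij]
  have hwj : ∀ s t u : ℝ, (w + u • (EuclideanSpace.single i s + EuclideanSpace.single j t)) j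
      = w j + u * t := fun s t u => by simp [hij.symm]
  have hci : ∀ s : ℝ, Tendsto (fun u : ℝ => (w i + u * s) ^ 2) (𝓝 0) (𝓝 (w i ^ 2)) := fun s => by
    simpa using (show Continuous fun u : ℝ => (w i + u * s) ^ 2 by fun_prop).tendsto 0
  have hκ : 0 < 1 + γ / α := by positivity
  have hl : 0 < 2 + γ / α := by positivity
  simp only [Set.mem_insert_iff, Set.mem_singleton_iff]
  -- the coordinate is stationary for the quadratic with derivative `w i / α`
  have hfirst : (∀ᶠ u : ℝ in 𝓝 0,
      conjugate (cost α β) (w + u • (EuclideanSpace.single i 1 + EuclideanSpace.single j 0))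
      = conjugate (cost α β) w + w i / α * u + 1 / (2 * α) * u ^ 2) →
      w i = (1 + γ / α)⁻¹ * q i := fun h => by
    have := hst _ _ _ h
    rw [hinner] at this
    rw [eq_inv_mul_iff_mul_eq₀ hκ.ne']
    have e : γ * (w i / α) = γ / α * w i := by ring
    linarith
  -- In direction $e_i$ the conjugate has kinks only where $w_i^2=w_j^2\le c$ or $w_i^2=c\le w_j^2$.
  -- Elsewhere its derivative is $0$ or $w_i/\alpha$, and stationarity determines $w_i$.
  rcases lt_trichotomy (w i ^ 2) c with hx | hx | hx
  · rcases lt_trichotomy (w i ^ 2) (w j ^ 2) with hxy | hxy | hxy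
    · right; left
      have := hst (EuclideanSpace.single i 1 + EuclideanSpace.single j 0) 0 0 (by
        filter_upwards [(hci 1).eventually_lt_const hx, (hci 1).eventually_lt_const hxy]
          with u h1 h2
        rw [hG, hG w, hwi, hwj, mul_zero, add_zero, conjSq_comm, conjSq_of_le hα h2.le h1.le,
          conjSq_comm, conjSq_of_le hα hxy.le hx.le]
        ring)
      rw [hinner] at this
      linarith
    -- On the kink $w_i=\sigma w_j$ the test direction is $e_i+\sigma e_j$, which stays on the kink,
    -- where the conjugate is the single quadratic $w_i^2/2\alpha$.
    · have hline : ∀ σ : ℝ, σ ^ 2 = 1 → w i = σ * w j →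
          w i = (2 + γ / α)⁻¹ * (q i + σ * q j) := fun σ hσ hw => by
        have hw' : w j = σ * w i := by rw [hw, ← mul_assoc, ← sq, hσ, one_mul]
        have := hst (EuclideanSpace.single i 1 + EuclideanSpace.single j σ) (w i / α)
          (1 / (2 * α)) (by
            filter_upwards [(hci 1).eventually_lt_const hx] with u h1
            have e : (w j + u * σ) ^ 2 = (w i + u * 1) ^ 2 := by
              rw [hw']
              linear_combination (w i + u) ^ 2 * hσ
            rw [hG, hG w, hwi, hwj, e, ← hxy, conjSq_of_le hα le_rfl h1.le,
              conjSq_of_le hα le_rfl hx.le]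
            field_simp; ring)
        rw [hinner, hw'] at this
        rw [eq_inv_mul_iff_mul_eq₀ hl.ne']
        have e : γ * (w i / α) = γ / α * w i := by ring
        linear_combination -this - e - w i * hσ
      rcases sq_eq_sq_iff_eq_or_eq_neg.1 hxy with h | h
      · have := hline 1 (by norm_num) (by linarith)
        rw [one_mul] at this
        tauto
      · have := hline (-1) (by norm_num) (by linarith)
        rw [neg_one_mul, ← sub_eq_add_neg] at this
        tauto
    · left
      refine hfirst ?_
      filter_upwards [(hci 1).eventually_const_lt hxy] with u h1
      rw [hG, hG w, hwi, hwj, mul_zero, add_zero, conjSq_of_le hα h1.le (hxy.trans hx).le,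
        conjSq_of_le hα hxy.le (hxy.trans hx).le]
      field_simp; ring
  · have hs : √c ^ 2 = c := Real.sq_sqrt (by positivity)
    rw [← hs] at hx
    rcases sq_eq_sq_iff_eq_or_eq_neg.1 hx with h | h <;> tauto
  · left
    refine hfirst ?_
    rcases le_or_gt (w j ^ 2) c with hy | hy
    · have hxy := hy.trans_lt hx
      filter_upwards [(hci 1).eventually_const_lt hxy] with u h1
      rw [hG, hG w, hwi, hwj, mul_zero, add_zero, conjSq_of_le hα h1.le hy,
        conjSq_of_le hα hxy.le hy]
      field_simp; ring
    · filter_upwards [(hci 1).eventually_const_lt hx] with u h1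
      rw [hG, hG w, hwi, hwj, mul_zero, add_zero, conjSq_of_ge hα h1.le hy.le,
        conjSq_of_ge hα hx.le hy.le]
      field_simp; ring

/-- Adding the variational inequalities at $q$ and $q'$, each tested with the other proximal point,
cancels the values of $g^*$. Substituting $q=\mathrm{prox}(q)+\gamma h_\gamma(q)$ gives the
estimate. -/
lemma hReg_cocoercive {α β γ : ℝ} (hα : 0 < α) (hβ : 0 < β) (hγ : 0 < γ) (q q' : Plane) :
    γ * ‖hReg α β γ q - hReg α β γ q'‖ ^ 2
      ≤ inner ℝ (hReg α β γ q - hReg α β γ q') (q - q') := by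
  have hv := prox_variational hγ (continuous_conjugate_cost hα hβ) (conjugate_cost_nonneg hα hβ)
    (convexOn_conjugate_cost hα hβ)
  have h1 := hv q (prox γ (conjugate (cost α β)) q')
  have h2 := hv q' (prox γ (conjugate (cost α β)) q)
  have e : ∀ q, q = prox γ (conjugate (cost α β)) q + γ • hReg α β γ q := fun q => by
    rw [hReg, smul_smul, mul_one_div_cancel hγ.ne', one_smul]; abel
  have e1 := e q
  have e2 := e q'
  set w := prox γ (conjugate (cost α β)) q
  set w' := prox γ (conjugate (cost α β)) q'
  set v := hReg α β γ q
  set v' := hReg α β γ q'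
  have f1 : q - w = γ • v := by rw [e1]; simp
  have f2 : q' - w' = γ • v' := by rw [e2]; simp
  rw [f1, inner_smul_left] at h1
  rw [f2, inner_smul_left] at h2
  simp only [conj_trivial] at h1 h2
  have f3 : q - q' = (w - w') + γ • (v - v') := by
    rw [e1, e2]; module
  rw [f3, inner_add_right, inner_smul_right, real_inner_self_eq_norm_sq]
  have f4 : inner ℝ (v - v') (w - w') = - inner ℝ v (w' - w) - inner ℝ v' (w - w') := by
    rw [inner_sub_left, ← inner_neg_right, neg_sub]
  have f5 : 0 ≤ γ * inner ℝ (v - v') (w - w') := by rw [f4]; linarith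
  have := nonneg_of_mul_nonneg_right f5 hγ
  linarith

lemma hReg_monotone {α β γ : ℝ} (hα : 0 < α) (hβ : 0 < β) (hγ : 0 < γ) (q q' : Plane) :
    0 ≤ inner ℝ (hReg α β γ q - hReg α β γ q') (q - q') :=
  le_trans (by positivity) (hReg_cocoercive hα hβ hγ q q')

lemma hReg_lipschitz {α β γ : ℝ} (hα : 0 < α) (hβ : 0 < β) (hγ : 0 < γ) (q q' : Plane) :
    ‖hReg α β γ q - hReg α β γ q'‖ ≤ γ⁻¹ * ‖q - q'‖ := by
  have h := (hReg_cocoercive hα hβ hγ q q').trans (real_inner_le_norm _ _)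
  rw [inv_mul_eq_div, le_div_iff₀ hγ]
  rcases (norm_nonneg (hReg α β γ q - hReg α β γ q')).eq_or_lt with h0 | h0
  · rw [← h0]; simp
  · nlinarith

/-! ### Continuous selections of finitely many affine maps -/

/-- `f` agrees at every point with one of finitely many affine maps `q ↦ A.1 q + A.2`. -/
def IsAffineSelection {E G : Type*} [NormedAddCommGroup E] [NormedSpace ℝ E]
    [NormedAddCommGroup G] [NormedSpace ℝ G] (f : E → G) (F : Set ((E →L[ℝ] G) × G)) : Prop :=
  F.Finite ∧ ∀ q, ∃ A ∈ F, f q = A.1 q + A.2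

lemma exists_isAffineSelection_prox_coord {α β γ : ℝ} (hα : 0 < α) (hβ : 0 < β) (hγ : 0 < γ)
    {i j : Fin 2} (hij : i ≠ j) :
    ∃ F, IsAffineSelection (fun q : Plane => prox γ (conjugate (cost α β)) q i) F := by
  let P : Fin 2 → Plane →L[ℝ] ℝ := EuclideanSpace.proj
  refine ⟨{((1 + γ / α)⁻¹ • P i, 0), (P i, 0), (0, √(2 * α * β)), (0, -√(2 * α * β)),
    ((2 + γ / α)⁻¹ • (P i + P j), 0), ((2 + γ / α)⁻¹ • (P i - P j), 0)}, by simp, fun q => ?_⟩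
  simpa [P, mul_add, mul_sub] using prox_coord_mem hα hβ hγ hij q

lemma exists_isAffineSelection_hReg {α β γ : ℝ} (hα : 0 < α) (hβ : 0 < β) (hγ : 0 < γ) :
    ∃ F, IsAffineSelection (hReg α β γ) F := by
  obtain ⟨F, hF, hF'⟩ := exists_isAffineSelection_prox_coord hα hβ hγ (zero_ne_one' (Fin 2))
  obtain ⟨G, hG, hG'⟩ := exists_isAffineSelection_prox_coord hα hβ hγ (zero_ne_one' (Fin 2)).symm
  let e : Fin 2 → Plane := fun i => EuclideanSpace.single i 1
  refine ⟨Set.image2 (fun A B => ((1 / γ) • (ContinuousLinearMap.id ℝ Plane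
    - (A.1.smulRight (e 0) + B.1.smulRight (e 1))), -(1 / γ) • (A.2 • e 0 + B.2 • e 1))) F G,
    hF.image2 _ hG, fun q => ?_⟩
  obtain ⟨A, hA, hA'⟩ := hF' q
  obtain ⟨B, hB, hB'⟩ := hG' q
  refine ⟨_, Set.mem_image2_of_mem hA hB, ?_⟩
  have hp : prox γ (conjugate (cost α β)) q = (A.1 q + A.2) • e 0 + (B.1 q + B.2) • e 1 := by
    rw [← hA', ← hB']
    ext i
    fin_cases i <;> simp [e]
  rw [hReg, hp]
  simp only [_root_.smul_apply, _root_.sub_apply,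
    _root_.add_apply, ContinuousLinearMap.id_apply,
    ContinuousLinearMap.smulRight_apply]
  module

section Selection

variable {E G : Type*} [NormedAddCommGroup E] [NormedSpace ℝ E] [NormedAddCommGroup G]
  [NormedSpace ℝ G] {f : E → G} {F : Set ((E →L[ℝ] G) × G)}

lemma IsAffineSelection.eventually_active (hF : IsAffineSelection f F) (hf : Continuous f)
    (q : E) : ∀ᶠ q' in 𝓝 q, ∀ A ∈ F, f q' = A.1 q' + A.2 → f q = A.1 q + A.2 := by
  rw [eventually_all_finite hF.1]
  intro A _
  by_cases h : f q = A.1 q + A.2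
  · exact Eventually.of_forall fun _ _ => h
  · have : ∀ᶠ q' in 𝓝 q, f q' - (A.1 q' + A.2) ≠ 0 :=
      (show Continuous fun q' => f q' - (A.1 q' + A.2) by fun_prop).continuousAt.eventually_ne
        (sub_ne_zero.2 h)
    filter_upwards [this] with q' h1 h2
    exact absurd (sub_eq_zero.2 h2) h1

/-- The pigeonhole principle along a filter. -/
lemma exists_frequently_of_finite {ι κ : Type*} {l : Filter ι} [l.NeBot] {F : Set κ}
    (hF : F.Finite) {P : ι → κ → Prop} (h : ∀ i, ∃ A ∈ F, P i A) : ∃ A ∈ F, ∃ᶠ i in l, P i A := by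
  by_contra! hc
  have : ∀ A ∈ F, ∀ᶠ i in l, ¬ P i A := hc
  obtain ⟨i, hi⟩ := ((eventually_all_finite hF).2 this).exists
  obtain ⟨A, hA, hP⟩ := h i
  exact hi A hA hP

/-- At a point of differentiability, the derivative of a continuous selection of finitely many
affine maps is the linear part of one of the active maps. -/
lemma IsAffineSelection.fderiv_mem (hF : IsAffineSelection f F) (hf : Continuous f) {q : E}
    (hq : DifferentiableAt ℝ f q) : ∃ A ∈ F, f q = A.1 q + A.2 ∧ fderiv ℝ f q = A.1 := by
  let I := {A : (E →L[ℝ] G) × G // A ∈ F ∧ f q = A.1 q + A.2}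
  have : Finite I := (hF.1.subset fun A (hA : A ∈ F ∧ f q = A.1 q + A.2) => hA.1).to_subtype
  let p : I → Subspace ℝ E := fun A => LinearMap.ker ((fderiv ℝ f q - A.1.1 : E →L[ℝ] G) : E →ₗ[ℝ] G)
  -- In each direction $d$ some map agrees with $f$ at $q+td$ for arbitrarily small $t\neq0$; it is
  -- active at $q$ and matches the derivative on $d$. A real vector space covered by finitely many
  -- subspaces equals one of them, so a single map serves all $d$.
  have hcov : ⋃ A, (p A : Set E) = Set.univ := by
    refine Set.eq_univ_of_forall fun d => ?_
    have hs := (hq.hasFDerivAt.hasLineDerivAt d).tendsto_slope_zero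
    obtain ⟨A, hA, hfr⟩ := exists_frequently_of_finite (l := 𝓝[≠] (0 : ℝ)) hF.1
      (P := fun t A => f (q + t • d) = A.1 (q + t • d) + A.2) fun t => hF.2 (q + t • d)
    have hlim : Tendsto (fun t : ℝ => q + t • d) (𝓝[≠] 0) (𝓝 q) := by
      have : Tendsto (fun t : ℝ => q + t • d) (𝓝 0) (𝓝 (q + (0 : ℝ) • d)) :=
        Continuous.tendsto (by fun_prop) 0
      rw [zero_smul, add_zero] at this
      exact this.mono_left nhdsWithin_le_nhds
    have hact : f q = A.1 q + A.2 := by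
      obtain ⟨t, h1, h2⟩ := (hfr.and_eventually (hlim.eventually (hF.eventually_active hf q))).exists
      exact h2 A hA h1
    have hd : fderiv ℝ f q d ∈ ({A.1 d} : Set G) := by
      refine isClosed_singleton.mem_of_frequently_of_tendsto ?_ hs
      refine (hfr.and_eventually self_mem_nhdsWithin).mono fun t ⟨h1, ht⟩ => ?_
      have : f (q + t • d) - f q = t • A.1 d := by rw [h1, hact, map_add, map_smul]; abel
      rw [this, smul_smul, inv_mul_cancel₀ ht, one_smul]
      rfl
    refine Set.mem_iUnion.2 ⟨⟨A, hA, hact⟩, ?_⟩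
    simpa [p, sub_eq_zero] using hd
  obtain ⟨A, hA⟩ := Subspace.exists_eq_top_of_iUnion_eq_univ hcov
  refine ⟨A.1, A.2.1, A.2.2, ?_⟩
  rw [← sub_eq_zero]
  ext d
  have : d ∈ p A := hA ▸ Submodule.mem_top
  simpa [p] using this

end Selection

/-! ### Clarke derivatives and local exactness -/

section Clarke

variable {f : Plane → Plane} {F : Set ((Plane →L[ℝ] Plane) × Plane)}

/-- A continuous selection of finitely many affine maps is semismooth, with an exact expansion in a
neighborhood of every point. -/
lemma IsAffineSelection.eventually_clarkeDeriv (hF : IsAffineSelection f F) (hf : Continuous f)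
    (q : Plane) :
    ∀ᶠ q' in 𝓝 q, ∀ B ∈ clarkeDeriv f q', f q' - f q = B (q' - q) := by
  filter_upwards [hF.eventually_active hf q] with q' hq' B hB
  -- The required identity is affine in $B$, so it suffices to check limits of derivatives.
  have hconv : Convex ℝ {B : Plane →L[ℝ] Plane | f q' - f q = B (q' - q)} := by
    intro B hB C hC a b _ _ hab
    simp only [Set.mem_ofPred_eq] at hB hC ⊢
    rw [_root_.add_apply, _root_.smul_apply, _root_.smul_apply, ← hB, ← hC, ← add_smul, hab,
      one_smul]
  refine convexHull_min ?_ hconv hB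
  rintro B ⟨s, hs, hsq, hsB⟩
  -- One map $A$ recurs along the sequence, so $B$ is its linear part, and its activity passes from
  -- the $s_k$ to $q'$ and then to $q$.
  obtain ⟨A, hA, hfr⟩ := exists_frequently_of_finite (l := atTop) hF.1
    (P := fun k A => f (s k) = A.1 (s k) + A.2 ∧ fderiv ℝ f (s k) = A.1)
    fun k => hF.fderiv_mem hf (hs k)
  have hBA : B ∈ ({A.1} : Set (Plane →L[ℝ] Plane)) :=
    isClosed_singleton.mem_of_frequently_of_tendsto (hfr.mono fun k hk => hk.2) hsB
  obtain ⟨k, h1, h2⟩ := (hfr.and_eventually (hsq.eventually (hF.eventually_active hf q'))).exists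
  have e1 := h2 A hA h1.1
  have e2 := hq' A hA e1
  rw [Set.mem_singleton_iff.1 hBA, Set.mem_ofPred_eq, map_sub, e1, e2]
  abel

/-- Norm bounds and positivity define closed convex sets of operators, so they pass from derivatives
to Clarke derivatives. -/
lemma clarkeDeriv_subset_of_isClosed {s : Set (Plane →L[ℝ] Plane)} (hs : IsClosed s)
    (hc : Convex ℝ s) (h : ∀ q, DifferentiableAt ℝ f q → fderiv ℝ f q ∈ s) (q : Plane) :
    clarkeDeriv f q ⊆ s := by
  refine convexHull_min ?_ hc
  rintro B ⟨s, hd, -, hB⟩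
  exact hs.mem_of_tendsto hB (Eventually.of_forall fun k => h _ (hd k))

lemma lipschitzWith_of_norm_sub_le {K : ℝ} (hK : 0 ≤ K)
    (hf : ∀ q q', ‖f q - f q'‖ ≤ K * ‖q - q'‖) : LipschitzWith K.toNNReal f :=
  LipschitzWith.of_dist_le_mul fun x y => by
    simpa only [dist_eq_norm, Real.coe_toNNReal K hK] using hf x y

lemma norm_le_of_mem_clarkeDeriv {K : ℝ} (hK : 0 ≤ K)
    (hf : ∀ q q', ‖f q - f q'‖ ≤ K * ‖q - q'‖) {q : Plane} {B : Plane →L[ℝ] Plane}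
    (hB : B ∈ clarkeDeriv f q) : ‖B‖ ≤ K := by
  have := clarkeDeriv_subset_of_isClosed (f := f) (s := Metric.closedBall 0 K)
    Metric.isClosed_closedBall (convex_closedBall _ _)
    (fun q _ => mem_closedBall_zero_iff.2 ((norm_fderiv_le_of_lipschitz ℝ
      (lipschitzWith_of_norm_sub_le hK hf)).trans_eq (Real.coe_toNNReal K hK))) q hB
  exact mem_closedBall_zero_iff.1 this

lemma inner_nonneg_of_mem_clarkeDeriv (hf : ∀ q q', 0 ≤ inner ℝ (f q - f q') (q - q'))
    {q : Plane} {B : Plane →L[ℝ] Plane} (hB : B ∈ clarkeDeriv f q) (v : Plane) :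
    0 ≤ inner ℝ (B v) v := by
  refine clarkeDeriv_subset_of_isClosed (f := f)
    (s := {B : Plane →L[ℝ] Plane | 0 ≤ inner ℝ (B v) v}) ?_ ?_ ?_ q hB
  · exact isClosed_le continuous_const (by fun_prop)
  · intro B hB C hC a b ha hb _
    simp only [Set.mem_ofPred_eq] at hB hC ⊢
    rw [_root_.add_apply, _root_.smul_apply, _root_.smul_apply, inner_add_left,
      real_inner_smul_left, real_inner_smul_left]
    positivity
  · intro q hq
    have hs := (hq.hasFDerivAt.hasLineDerivAt v).tendsto_slope_zero
    have hs' : Tendsto (fun t : ℝ => inner ℝ (t⁻¹ • (f (q + t • v) - f q)) v) (𝓝[≠] 0)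
        (𝓝 (inner ℝ (fderiv ℝ f q v) v)) := hs.inner tendsto_const_nhds
    refine ge_of_tendsto hs' ?_
    filter_upwards [self_mem_nhdsWithin] with t ht
    have h1 := hf (q + t • v) q
    rw [add_sub_cancel_left, real_inner_smul_right] at h1
    rw [real_inner_smul_left]
    -- Writing $t^{-1}=t^{-2}t$ handles both signs of $t$ at once.
    have : t⁻¹ * inner ℝ (f (q + t • v) - f q) v
        = (t⁻¹) ^ 2 * (t * inner ℝ (f (q + t • v) - f q) v) := by
      have : t ≠ 0 := ht
      field_simp
    rw [this]
    positivity

/-- The points around which the expansion of `f` by its Clarke derivative is exact up to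
distance `ρ`. -/
def exactPoints (f : Plane → Plane) (ρ : ℝ) : Set Plane :=
  {q | ∀ q', ‖q' - q‖ < ρ → ∀ B ∈ clarkeDeriv f q', f q' - f q = B (q' - q)}

/-- With $q'$ and $B$ fixed, the strict inequality $\|q'-q\|<\rho$ survives small changes of $q$,
and the identity is continuous in $q$. Closedness supplies the measurability of the exceptional
sets. -/
lemma isClosed_exactPoints (hf : Continuous f) (ρ : ℝ) : IsClosed (exactPoints f ρ) := by
  refine IsSeqClosed.isClosed fun s q hs hq q' hq' B hB => ?_
  have h1 : Tendsto (fun k => f q' - f (s k) - B (q' - s k)) atTop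
      (𝓝 (f q' - f q - B (q' - q))) :=
    ((show Continuous fun x => f q' - f x - B (q' - x) by fun_prop).tendsto q).comp hq
  have h2 : ∀ᶠ k in atTop, f q' - f (s k) - B (q' - s k) = 0 := by
    have : Tendsto (fun k => ‖q' - s k‖) atTop (𝓝 ‖q' - q‖) := (tendsto_const_nhds.sub hq).norm
    filter_upwards [this.eventually_lt_const hq'] with k hk
    exact sub_eq_zero.2 (hs k q' hk B hB)
  exact sub_eq_zero.1 (tendsto_nhds_unique h1 (tendsto_const_nhds.congr' (h2.mono fun _ h => h.symm)))

lemma exactPoints_anti {ρ ρ' : ℝ} (h : ρ ≤ ρ') : exactPoints f ρ' ⊆ exactPoints f ρ :=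
  fun _ hq q' hq' => hq q' (hq'.trans_le h)

end Clarke

/-! ### Strongly monotone equations in Hilbert space -/

section StronglyMonotone

variable {Y : Type*} [NormedAddCommGroup Y] [InnerProductSpace ℝ Y]

/-- Zarantonello's theorem: a Lipschitz continuous strongly monotone map on a Hilbert space is
surjective. -/
lemma surjective_of_stronglyMonotone [CompleteSpace Y] {F : Y → Y} {L : ℝ}
    (hL : ∀ a b, ‖F a - F b‖ ≤ L * ‖a - b‖)
    (hm : ∀ a b, ‖a - b‖ ^ 2 ≤ inner ℝ (F a - F b) (a - b)) : Function.Surjective F := by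
  intro w
  set k := max L 1
  have hk : 1 ≤ k := le_max_right _ _
  have hk0 : 0 < k := by linarith
  have hk2 : 0 ≤ 1 - (k ^ 2)⁻¹ := sub_nonneg.2 (inv_le_one_of_one_le₀ (one_le_pow₀ hk))
  have hτ : 0 < (k ^ 2)⁻¹ := by positivity
  -- This damping gives the squared contraction factor $1-2\tau+\tau^2k^2=1-\tau$, and $k\ge1$ keeps
  -- it nonnegative.
  set τ := (k ^ 2)⁻¹ with hτ_def
  have hτk : τ * k ^ 2 = 1 := inv_mul_cancel₀ (by positivity)
  have hcontr : ContractingWith (Real.toNNReal √(1 - τ)) fun y => y - τ • (F y - w) := by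
    constructor
    · rw [← NNReal.coe_lt_coe, Real.coe_toNNReal _ (Real.sqrt_nonneg _), NNReal.coe_one,
        Real.sqrt_lt' one_pos]
      linarith
    · refine LipschitzWith.of_dist_le_mul fun a b => ?_
      rw [Real.coe_toNNReal _ (Real.sqrt_nonneg _), dist_eq_norm, dist_eq_norm]
      refine le_of_sq_le_sq ?_ (by positivity)
      have e : a - τ • (F a - w) - (b - τ • (F b - w)) = (a - b) - τ • (F a - F b) := by module
      rw [e, norm_sub_sq_real, real_inner_smul_right, norm_smul, mul_pow, mul_pow,
        Real.sq_sqrt hk2, Real.norm_eq_abs, sq_abs, real_inner_comm]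
      have h1 : ‖F a - F b‖ ^ 2 ≤ k ^ 2 * ‖a - b‖ ^ 2 := by
        rw [← mul_pow]
        exact pow_le_pow_left₀ (norm_nonneg _) ((hL a b).trans (by gcongr; exact le_max_left _ _)) 2
      have h2 := mul_le_mul_of_nonneg_left (hm a b) hτ.le
      have h3 := mul_le_mul_of_nonneg_left h1 (sq_nonneg τ)
      have h4 : τ ^ 2 * (k ^ 2 * ‖a - b‖ ^ 2) = τ * ‖a - b‖ ^ 2 := by
        linear_combination τ * ‖a - b‖ ^ 2 * hτk
      linarith
  refine ⟨hcontr.fixedPoint, ?_⟩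
  have h : hcontr.fixedPoint - τ • (F hcontr.fixedPoint - w) = hcontr.fixedPoint :=
    hcontr.fixedPoint_isFixedPt
  rw [sub_eq_self, smul_eq_zero, or_iff_right hτ.ne', sub_eq_zero] at h
  exact h

lemma norm_sub_le_of_stronglyMonotone {F : Y → Y}
    (hm : ∀ a b, ‖a - b‖ ^ 2 ≤ inner ℝ (F a - F b) (a - b)) (a b : Y) :
    ‖a - b‖ ≤ ‖F a - F b‖ := by
  have h := (hm a b).trans (real_inner_le_norm _ _)
  rcases (norm_nonneg (a - b)).eq_or_lt with h0 | h0
  · rw [← h0]; positivity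
  · nlinarith

end StronglyMonotone

/-! ### The pointwise properties behind the Newton analysis -/

/-- The properties of a superposed function used for the Newton method: it is Lipschitz
continuous, monotone, and its expansion by the Clarke derivative is locally exact. -/
structure IsMonotoneSemismooth (h : Plane → Plane) (K : ℝ) : Prop where
  nonneg : 0 ≤ K
  lipschitz : ∀ q q', ‖h q - h q'‖ ≤ K * ‖q - q'‖
  monotone : ∀ q q', 0 ≤ inner ℝ (h q - h q') (q - q')
  locallyExact : ∀ q, ∀ᶠ q' in 𝓝 q, ∀ B ∈ clarkeDeriv h q', h q' - h q = B (q' - q)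

lemma IsMonotoneSemismooth.continuous {h : Plane → Plane} {K : ℝ}
    (hh : IsMonotoneSemismooth h K) : Continuous h :=
  (lipschitzWith_of_norm_sub_le hh.nonneg hh.lipschitz).continuous

/-- All the information about the switching cost that the function space arguments use. -/
lemma isMonotoneSemismooth_hReg {α β γ : ℝ} (hα : 0 < α) (hβ : 0 < β) (hγ : 0 < γ) :
    IsMonotoneSemismooth (hReg α β γ) γ⁻¹ where
  nonneg := by positivity
  lipschitz := hReg_lipschitz hα hβ hγ
  monotone := hReg_monotone hα hβ hγ
  locallyExact := by
    obtain ⟨F, hF⟩ := exists_isAffineSelection_hReg hα hβ hγ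
    exact hF.eventually_clarkeDeriv
      (lipschitzWith_of_norm_sub_le (inv_nonneg.2 hγ.le) (hReg_lipschitz hα hβ hγ)).continuous

/-! ### Estimates in $L^2$ on sets of small measure -/

section ToL2

variable {X : Type*} [MeasurableSpace X] {μ : Measure X}

lemma coeFn_toL2 {f : X → Plane} (hf : MemLp f 2 μ) : toL2 μ f =ᵐ[μ] f := by
  rw [toL2, dif_pos hf]
  exact hf.coeFn_toLp

lemma toL2_sub {f g : X → Plane} (hf : MemLp f 2 μ) (hg : MemLp g 2 μ) :
    toL2 μ f - toL2 μ g = toL2 μ fun x => f x - g x := by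
  have hfg : MemLp (fun x => f x - g x) 2 μ := hf.sub hg
  rw [toL2, toL2, toL2, dif_pos hf, dif_pos hg, dif_pos hfg]
  exact (MemLp.toLp_sub hf hg).symm

lemma toL2_congr {f g : X → Plane} (h : f =ᵐ[μ] g) : toL2 μ f = toL2 μ g := by
  by_cases hf : MemLp f 2 μ
  · have hg := hf.ae_eq h
    rw [toL2, toL2, dif_pos hf, dif_pos hg]
    exact MemLp.toLp_congr hf hg h
  · have hg : ¬ MemLp g 2 μ := fun hg => hf (hg.ae_eq h.symm)
    rw [toL2, toL2, dif_neg hf, dif_neg hg]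

/-- The Hölder exponent of the embedding of `L^r` into `L²` on sets of small measure. -/
def gapExponent (r : ℝ≥0∞) : ℝ := 1 / 2 - 1 / r.toReal

lemma gapExponent_pos {r : ℝ≥0∞} (hr : 2 < r) : 0 < gapExponent r := by
  unfold gapExponent
  -- For $r=\infty$ the conventions `∞.toReal = 0` and `1 / 0 = 0` give the correct exponent $1/2$.
  by_cases h : r = ∞
  · simp [h]
  · have h2 : (2 : ℝ) < r.toReal := by
      simpa using (ENNReal.toReal_lt_toReal (by simp) h).2 hr
    exact sub_pos.2 (one_div_lt_one_div_of_lt two_pos h2)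

/-- A function dominated by the restriction to `E` of an `L^r` function is small in `L²` if `E` has
small measure. -/
lemma norm_toL2_le [IsFiniteMeasure μ] {r : ℝ≥0∞} [Fact (1 ≤ r)] (hr : 2 < r) {f : X → Plane}
    {g : Lp Plane r μ} {c : ℝ} (hc : 0 ≤ c) {E : Set X} (hE : MeasurableSet E)
    (hfg : ∀ᵐ x ∂μ, ‖f x‖ ≤ c * ‖E.indicator g x‖) :
    ‖toL2 μ f‖ ≤ c * (‖g‖ * μ.real E ^ gapExponent r) := by
  by_cases hf : MemLp f 2 μ
  swap
  · rw [toL2, dif_neg hf, norm_zero]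
    positivity
  rw [toL2, dif_pos hf, Lp.norm_toLp]
  have h1 := eLpNorm_le_mul_eLpNorm_of_ae_le_mul hfg 2
  have h2 : eLpNorm (E.indicator g) 2 μ ≤ eLpNorm g r μ * μ E ^ gapExponent r := by
    rw [eLpNorm_indicator_eq_eLpNorm_restrict hE]
    refine (eLpNorm_le_eLpNorm_mul_rpow_measure_univ hr.le
      (Lp.aestronglyMeasurable g).restrict).trans ?_
    simp only [Measure.restrict_apply_univ, ENNReal.toReal_ofNat]
    exact mul_le_mul_left (eLpNorm_restrict_le _ _ _ _) _
  have h3 := h1.trans (mul_le_mul_right h2 (ENNReal.ofReal c))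
  have hθ := gapExponent_pos hr
  have hfin : ENNReal.ofReal c * (eLpNorm g r μ * μ E ^ gapExponent r) ≠ ∞ :=
    ENNReal.mul_ne_top ENNReal.ofReal_ne_top (ENNReal.mul_ne_top (Lp.eLpNorm_ne_top g)
      (ENNReal.rpow_ne_top_of_nonneg hθ.le (measure_ne_top μ E)))
  refine (ENNReal.toReal_mono hfin h3).trans (le_of_eq ?_)
  rw [ENNReal.toReal_mul, ENNReal.toReal_mul, ENNReal.toReal_ofReal hc, ← ENNReal.toReal_rpow,
    Lp.norm_def, Measure.real]

/-- Every value $f(x)$ has a positive radius of exactness, so these sets decrease to $\emptyset$,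
and a finite measure is continuous from above. -/
lemma tendsto_measureReal_not_exact [IsFiniteMeasure μ] {r : ℝ≥0∞} {h : Plane → Plane} {K : ℝ}
    (hh : IsMonotoneSemismooth h K) (f : Lp Plane r μ) :
    Tendsto (fun n : ℕ => μ.real (f ⁻¹' (exactPoints h (1 / (n + 1)))ᶜ)) atTop (𝓝 0) := by
  have hmeas : ∀ n : ℕ, MeasurableSet (f ⁻¹' (exactPoints h (1 / (n + 1)))ᶜ) := fun n =>
    (Lp.stronglyMeasurable f).measurable
      (isClosed_exactPoints hh.continuous _).isOpen_compl.measurableSet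
  have hanti : Antitone fun n : ℕ => f ⁻¹' (exactPoints h (1 / (n + 1)))ᶜ := fun m n hmn =>
    Set.preimage_mono (Set.compl_subset_compl.2 (exactPoints_anti
      (one_div_le_one_div_of_le (by positivity) (by gcongr))))
  have hinter : ⋂ n : ℕ, f ⁻¹' (exactPoints h (1 / (n + 1)))ᶜ = ∅ := by
    refine Set.eq_empty_of_forall_notMem fun x hx => ?_
    obtain ⟨ρ, hρ, hball⟩ := Metric.eventually_nhds_iff.1 (hh.locallyExact (f x))
    obtain ⟨n, hn⟩ := exists_nat_one_div_lt hρ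
    refine Set.mem_iInter.1 hx n fun q' hq' => hball ?_
    rw [dist_eq_norm]
    exact hq'.trans hn
  have := tendsto_measure_iInter_atTop (μ := μ) (fun n => (hmeas n).nullMeasurableSet) hanti
    ⟨0, measure_ne_top μ _⟩
  rw [hinter, measure_empty] at this
  exact (ENNReal.tendsto_toReal ENNReal.zero_ne_top).comp this

end ToL2

/-! ### The superposition operator and its Newton derivative -/

section Superposition

variable {X : Type*} [MeasurableSpace X] {μ : Measure X} {r : ℝ≥0∞}
  [Fact (1 ≤ r)] {V : Type*} [NormedAddCommGroup V] [NormedSpace ℝ V]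
  {ι : V →L[ℝ] Lp Plane r μ} {h : Plane → Plane} {K : ℝ} {M : V → X → (Plane →L[ℝ] Plane)}

lemma coeFn_map_sub (p q : V) : ι (p - q) =ᵐ[μ] fun x => ι p x - ι q x := by
  rw [map_sub]
  exact Lp.coeFn_sub _ _

/-- The constant of the embedding of `V` into `L²`. -/
def embeddingConst (ι : V →L[ℝ] Lp Plane r μ) : ℝ := ‖ι‖ * μ.real Set.univ ^ gapExponent r

lemma embeddingConst_nonneg : 0 ≤ embeddingConst ι := by unfold embeddingConst; positivity

/-- Convergence in $L^r$ implies convergence in measure, also for $r=\infty$. -/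
lemma tendsto_measureReal_norm_ge {c : ℝ} (hc : 0 < c) :
    Tendsto (fun δ : V => μ.real {x | c ≤ ‖ι δ x‖}) (𝓝 0) (𝓝 0) := by
  have hr0 : r ≠ 0 := (zero_lt_one.trans_le (Fact.out : 1 ≤ r)).ne'
  have hmeas : TendstoInMeasure μ (fun (δ : V) x => ι δ x) (𝓝 0) fun _ => 0 := by
    refine tendstoInMeasure_of_tendsto_eLpNorm hr0 (fun δ => Lp.aestronglyMeasurable _)
      aestronglyMeasurable_const ?_
    have h1 : Tendsto (fun δ : V => ‖ι δ‖ₑ) (𝓝 0) (𝓝 0) := by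
      have := (ι.continuous.enorm).tendsto 0
      simpa using this
    refine h1.congr fun δ => ?_
    rw [Lp.enorm_def]
    congr 1
    ext x
    simp
  have h2 := (ENNReal.tendsto_toReal ENNReal.zero_ne_top).comp
    (hmeas (ENNReal.ofReal c) (ENNReal.ofReal_pos.2 hc))
  refine h2.congr fun δ => ?_
  simp only [Function.comp, Measure.real]
  congr 3
  ext x
  rw [edist_zero_right, ← ofReal_norm, ENNReal.ofReal_le_ofReal_iff (norm_nonneg _)]

lemma IsClarkeSelection.ae_norm_le (hM : IsClarkeSelection h ι M) (hh : IsMonotoneSemismooth h K)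
    (p : V) : ∀ᵐ x ∂μ, ‖M p x‖ ≤ K := by
  filter_upwards [(hM p).2] with x hx
  exact norm_le_of_mem_clarkeDeriv hh.nonneg hh.lipschitz hx

variable [IsFiniteMeasure μ]

lemma memLp_two (hr : 2 < r) (p : V) : MemLp (ι p) 2 μ := (Lp.memLp (ι p)).mono_exponent hr.le

lemma memLp_superposition (hr : 2 < r) (hh : IsMonotoneSemismooth h K) (p : V) :
    MemLp (fun x => h (ι p x)) 2 μ := by
  have h1 : MemLp (fun x => h (ι p x) - h 0) 2 μ := by
    refine (memLp_two (ι := ι) hr p).of_le_mul (c := K) ?_ (Eventually.of_forall fun x => ?_)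
    · exact (hh.continuous.comp_aestronglyMeasurable (Lp.aestronglyMeasurable _)).sub
        aestronglyMeasurable_const
    · simpa using hh.lipschitz (ι p x) 0
  refine (h1.add (memLp_const (h 0))).congr_norm
    (hh.continuous.comp_aestronglyMeasurable (Lp.aestronglyMeasurable _))
    (Eventually.of_forall fun x => ?_)
  simp

lemma memLp_newtonDeriv (hr : 2 < r) (hh : IsMonotoneSemismooth h K)
    (hM : IsClarkeSelection h ι M) (p δ : V) : MemLp (fun x => M p x (ι δ x)) 2 μ := by
  refine (memLp_two (ι := ι) hr δ).of_le_mul (c := K) ?_ ?_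
  · exact isBoundedBilinearMap_apply.continuous.comp_aestronglyMeasurable
      ((hM p).1.prodMk (Lp.aestronglyMeasurable (ι δ)))
  · filter_upwards [hM.ae_norm_le hh p] with x hx
    exact (M p x).le_of_opNorm_le hx _

lemma norm_toL2_le_of_embedding (hr : 2 < r) {f : X → Plane} {c : ℝ} (hc : 0 ≤ c) (a : V)
    (hf : ∀ᵐ x ∂μ, ‖f x‖ ≤ c * ‖ι a x‖) : ‖toL2 μ f‖ ≤ c * embeddingConst ι * ‖a‖ := by
  refine (norm_toL2_le hr hc MeasurableSet.univ (g := ι a) ?_).trans ?_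
  · simpa using hf
  · rw [embeddingConst, mul_assoc, mul_right_comm]
    gcongr
    exact ι.le_opNorm a

lemma superposition_sub_norm_le (hr : 2 < r) (hh : IsMonotoneSemismooth h K) (p q : V) :
    ‖superposition h ι p - superposition h ι q‖ ≤ K * embeddingConst ι * ‖p - q‖ := by
  rw [superposition, superposition,
    toL2_sub (memLp_superposition hr hh p) (memLp_superposition hr hh q)]
  refine norm_toL2_le_of_embedding hr hh.nonneg _ ?_
  filter_upwards [coeFn_map_sub (ι := ι) p q] with x hx
  rw [hx]
  exact hh.lipschitz _ _

/-- The vector $u$ is $\iota(p-q)$ seen in $L^2$; in the applications it is a value of $S^*$. -/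
lemma superposition_monotone (hr : 2 < r) (hh : IsMonotoneSemismooth h K) (p q : V)
    {u : Lp Plane 2 μ} (hu : ι (p - q) =ᵐ[μ] u) :
    0 ≤ inner ℝ (superposition h ι p - superposition h ι q) u := by
  have hp := memLp_superposition (ι := ι) hr hh p
  have hq := memLp_superposition (ι := ι) hr hh q
  rw [superposition, superposition, toL2_sub hp hq, L2.inner_def]
  refine integral_nonneg_of_ae ?_
  filter_upwards [coeFn_map_sub (ι := ι) p q, hu, coeFn_toL2 (hp.sub hq)] with x h1 h2 h3
  have h4 : toL2 μ (fun x => h (ι p x) - h (ι q x)) x = h (ι p x) - h (ι q x) := h3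
  rw [h4, ← h2, h1]
  exact hh.monotone _ _

lemma newtonDeriv_sub (hr : 2 < r) (hh : IsMonotoneSemismooth h K)
    (hM : IsClarkeSelection h ι M) (p a b : V) :
    newtonDeriv ι M p (a - b) = newtonDeriv ι M p a - newtonDeriv ι M p b := by
  rw [newtonDeriv, newtonDeriv, newtonDeriv,
    toL2_sub (memLp_newtonDeriv hr hh hM p a) (memLp_newtonDeriv hr hh hM p b)]
  refine toL2_congr ?_
  filter_upwards [coeFn_map_sub (ι := ι) a b] with x hx
  rw [hx, map_sub]

lemma newtonDeriv_norm_le (hr : 2 < r) (hh : IsMonotoneSemismooth h K)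
    (hM : IsClarkeSelection h ι M) (p a : V) :
    ‖newtonDeriv ι M p a‖ ≤ K * embeddingConst ι * ‖a‖ := by
  refine norm_toL2_le_of_embedding hr hh.nonneg _ ?_
  filter_upwards [hM.ae_norm_le hh p] with x hx
  exact (M p x).le_of_opNorm_le hx _

lemma newtonDeriv_inner_nonneg (hr : 2 < r) (hh : IsMonotoneSemismooth h K)
    (hM : IsClarkeSelection h ι M) (p a : V) {u : Lp Plane 2 μ} (hu : ι a =ᵐ[μ] u) :
    0 ≤ inner ℝ (newtonDeriv ι M p a) u := by
  rw [newtonDeriv, L2.inner_def]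
  refine integral_nonneg_of_ae ?_
  filter_upwards [coeFn_toL2 (memLp_newtonDeriv hr hh hM p a), hu, (hM p).2] with x h1 h2 h3
  rw [h1, ← h2]
  exact inner_nonneg_of_mem_clarkeDeriv hh.monotone h3 _

/-- Newton differentiability of the superposition operator. -/
theorem superposition_newtonDifferentiable (hr : 2 < r) (hh : IsMonotoneSemismooth h K)
    (hM : IsClarkeSelection h ι M) (p : V) :
    (fun δ : V => superposition h ι (p + δ) - superposition h ι p - newtonDeriv ι M (p + δ) δ)
      =o[𝓝 0] fun δ : V => δ := by
  refine isLittleO_iff.2 fun c hc => ?_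
  have hK := hh.nonneg
  have hθ := gapExponent_pos hr
  obtain ⟨η, hη, hηc⟩ : ∃ η : ℝ, 0 < η ∧ 2 * K * (‖ι‖ * η ^ gapExponent r) < c := by
    have hcont : Tendsto (fun η : ℝ => 2 * K * (‖ι‖ * η ^ gapExponent r)) (𝓝[>] 0) (𝓝 0) := by
      have := ((Real.continuous_rpow_const hθ.le).const_mul ‖ι‖).const_mul (2 * K)
      have := (this.tendsto 0).mono_left (nhdsWithin_le_nhds (s := Set.Ioi 0))
      simpa [Real.zero_rpow hθ.ne'] using this
    obtain ⟨η, h1, h2⟩ := ((hcont.eventually_lt_const hc).and self_mem_nhdsWithin).exists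
    exact ⟨η, h2, h1⟩
  obtain ⟨n, hn⟩ := ((tendsto_measureReal_not_exact hh (ι p)).eventually_lt_const
    (half_pos hη)).exists
  have hρ : (0 : ℝ) < 1 / (n + 1) := by positivity
  filter_upwards [(tendsto_measureReal_norm_ge (ι := ι) hρ).eventually_lt_const (half_pos hη)]
    with δ hδ
  -- Off $E$ the residual vanishes identically; on $E$ it is at most $2K|\delta p(x)|$, half from
  -- the Lipschitz bound and half from $\|M\|\le K$.
  set E : Set X := ι p ⁻¹' (exactPoints h (1 / (n + 1)))ᶜ ∪ {x | (1 : ℝ) / (n + 1) ≤ ‖ι δ x‖}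
    with hE_def
  have hE : MeasurableSet E :=
    ((Lp.stronglyMeasurable _).measurable
      (isClosed_exactPoints hh.continuous _).isOpen_compl.measurableSet).union
      (measurableSet_le measurable_const (Lp.stronglyMeasurable _).norm.measurable)
  have hμE : μ.real E ≤ η := (measureReal_union_le _ _).trans (by linarith)
  have h1 := memLp_superposition (ι := ι) hr hh (p + δ)
  have h2 := memLp_superposition (ι := ι) hr hh p
  have h12 : MemLp (fun x => h (ι (p + δ) x) - h (ι p x)) 2 μ := h1.sub h2
  have h3 := memLp_newtonDeriv hr hh hM (p + δ) δ
  rw [superposition, superposition, newtonDeriv, toL2_sub h1 h2, toL2_sub h12 h3]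
  have hbound := norm_toL2_le hr (g := ι δ) (c := 2 * K) (by positivity) hE
    (f := fun x => h (ι (p + δ) x) - h (ι p x) - M (p + δ) x (ι δ x)) (by
      have hadd : ι (p + δ) =ᵐ[μ] fun x => ι p x + ι δ x := by
        rw [map_add]; exact Lp.coeFn_add _ _
      filter_upwards [hadd, (hM (p + δ)).2, hM.ae_norm_le hh (p + δ)] with x hx hx1 hx2
      have hδx : ι (p + δ) x - ι p x = ι δ x := by rw [hx, add_sub_cancel_left]
      by_cases hxE : x ∈ E
      · rw [Set.indicator_of_mem hxE]
        refine (norm_sub_le _ _).trans ?_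
        have k1 := hh.lipschitz (ι (p + δ) x) (ι p x)
        rw [hδx] at k1
        have k2 := (M (p + δ) x).le_of_opNorm_le hx2 (ι δ x)
        linarith
      · rw [hE_def, Set.mem_union, not_or] at hxE
        have k1 : ι p x ∈ exactPoints h (1 / (n + 1)) := by simpa using hxE.1
        have k2 : ‖ι δ x‖ < 1 / ((n : ℝ) + 1) := not_le.1 hxE.2
        have := k1 (ι (p + δ) x) (by rwa [hδx]) _ hx1
        rw [this, hδx, sub_self, norm_zero]
        positivity)
  refine hbound.trans ?_
  calc 2 * K * (‖ι δ‖ * μ.real E ^ gapExponent r)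
      ≤ 2 * K * ((‖ι‖ * ‖δ‖) * η ^ gapExponent r) := by
        gcongr
        exact ι.le_opNorm δ
    _ = 2 * K * (‖ι‖ * η ^ gapExponent r) * ‖δ‖ := by ring
    _ ≤ c * ‖δ‖ := by gcongr

end Superposition

/-! ### Solvability of the systems and convergence of the iteration -/

section Newton

variable {X : Type*} [MeasurableSpace X] {μ : Measure X} [IsFiniteMeasure μ] {r : ℝ≥0∞}
  [Fact (1 ≤ r)] {V : Type*} [NormedAddCommGroup V] [NormedSpace ℝ V]
  {ι : V →L[ℝ] Lp Plane r μ} {h : Plane → Plane} {K : ℝ} {M : V → X → (Plane →L[ℝ] Plane)}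
  {Y : Type*} [NormedAddCommGroup Y] [InnerProductSpace ℝ Y]
  {S : Lp Plane 2 μ →L[ℝ] Y} {T : Y →L[ℝ] V}

/-- The error of a Newton step solves the Newton system with the linearization residual as right
hand side. -/
lemma IsNewtonStep.newtonSystem_error (hr : 2 < r) (hh : IsMonotoneSemismooth h K)
    (hM : IsClarkeSelection h ι M) {z : Y} {xs x x' : Y × V} (hxs : IsSolution h ι S T z xs)
    (hx : IsNewtonStep h ι M S T z x x') :
    NewtonSystem ι M S T x.2 (x' - xs) (S (superposition h ι x.2 - superposition h ι xs.2
      - newtonDeriv ι M x.2 (x.2 - xs.2)), 0) := by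
  obtain ⟨δ, ⟨h1, h2⟩, rfl⟩ := hx
  obtain ⟨e1, e2⟩ := hxs
  dsimp only at h1 h2
  have h3 : newtonDeriv ι M x.2 (x + δ - xs).2
      = newtonDeriv ι M x.2 δ.2 + newtonDeriv ι M x.2 (x.2 - xs.2) := by
    rw [← sub_eq_iff_eq_add, ← newtonDeriv_sub hr hh hM]
    congr 1
    simp only [Prod.snd_sub, Prod.snd_add]; abel
  constructor
  · rw [h3]
    simp only [Prod.fst_sub, Prod.fst_add, map_sub, map_add]
    rw [← e1]
    have : δ.1 = -x.1 + S (superposition h ι x.2) + S (newtonDeriv ι M x.2 δ.2) := by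
      rw [← h1]; abel
    rw [this]
    abel
  · simp only [Prod.snd_sub, Prod.snd_add, Prod.fst_sub, Prod.fst_add, map_sub, map_add] at h2 ⊢
    have e3 : xs.2 = T z - T xs.1 := by
      rw [map_sub, neg_sub] at e2; exact e2
    have : δ.2 = -x.2 - (T x.1 - T z) - T δ.1 := by rw [← h2]; abel
    rw [this, e3]
    abel

variable [CompleteSpace Y]

/-- With $p=-S^*(y-z)$ the system becomes $y-SH(-S^*(y-z))=0$. The minus sign inside $H$ makes the
left side strongly monotone. -/
lemma exists_isSolution (hr : 2 < r) (hh : IsMonotoneSemismooth h K)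
    (hT : ∀ y : Y, ι (T y) =ᵐ[μ] ContinuousLinearMap.adjoint S y) (z : Y) :
    ∃ x : Y × V, IsSolution h ι S T z x := by
  let F : Y → Y := fun y => y - S (superposition h ι (-T (y - z)))
  have hp : ∀ a b : Y, -T (a - z) - -T (b - z) = T (b - a) := fun a b => by
    simp only [map_sub]; abel
  have hF : ∀ a b, F a - F b = (a - b)
      - S (superposition h ι (-T (a - z)) - superposition h ι (-T (b - z))) := fun a b => by
    simp only [F, map_sub]; abel
  have hsurj : Function.Surjective F := by
    refine surjective_of_stronglyMonotone (L := 1 + ‖S‖ * (K * embeddingConst ι * ‖T‖)) ?_ ?_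
    · intro a b
      rw [hF, add_mul, one_mul]
      refine (norm_sub_le _ _).trans (add_le_add_right ?_ _)
      refine (S.le_opNorm _).trans ?_
      rw [mul_assoc, mul_assoc]
      gcongr
      refine (superposition_sub_norm_le hr hh _ _).trans ?_
      rw [hp]
      have := hh.nonneg
      have := embeddingConst_nonneg (ι := ι)
      gcongr
      rw [norm_sub_rev]
      exact T.le_opNorm _
    · intro a b
      have h1 := superposition_monotone (ι := ι) hr hh (-T (a - z)) (-T (b - z))
        (u := ContinuousLinearMap.adjoint S (b - a)) (by rw [hp]; exact hT _)
      rw [ContinuousLinearMap.adjoint_inner_right, ← neg_sub a b, inner_neg_right] at h1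
      rw [hF, inner_sub_left, real_inner_self_eq_norm_sq]
      linarith
  obtain ⟨y, hy⟩ := hsurj 0
  exact ⟨(y, -T (y - z)), sub_eq_zero.1 hy, rfl⟩

/-- Inserting $\delta p=w_2-S^*\delta y$ leaves $(I+SDS^*)\delta y=w_1+SDw_2$ with $D=D_NH(p)$. Here
$\langle SDS^*y,y\rangle=\langle DS^*y,S^*y\rangle\ge0$, and $\|SD\|\le c$ independently of $p$. -/
lemma newtonSystem_solvable (hr : 2 < r) (hh : IsMonotoneSemismooth h K)
    (hM : IsClarkeSelection h ι M)
    (hT : ∀ y : Y, ι (T y) =ᵐ[μ] ContinuousLinearMap.adjoint S y) :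
    ∃ C : ℝ, 0 ≤ C ∧ ∀ (p : V) (w : Y × V), ∃ δ : Y × V, NewtonSystem ι M S T p δ w ∧
      (∀ δ' : Y × V, NewtonSystem ι M S T p δ' w → δ' = δ) ∧
      ‖δ.1‖ + ‖δ.2‖ ≤ C * (‖w.1‖ + ‖w.2‖) := by
  have hK := hh.nonneg
  have hι := embeddingConst_nonneg (ι := ι)
  set c := ‖S‖ * (K * embeddingConst ι) with hc_def
  have hc : 0 ≤ c := by positivity
  -- The constant combines $\|\delta y\|\le(1+c)(\|w_1\|+\|w_2\|)$ with $\|\delta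
  -- p\|\le\|w_2\|+\|T\|\|\delta y\|$.
  refine ⟨(1 + ‖T‖) * (1 + c) + 1, by positivity, fun p w => ?_⟩
  have hSD : ∀ a, ‖S (newtonDeriv ι M p a)‖ ≤ c * ‖a‖ := fun a => by
    refine (S.le_opNorm _).trans ?_
    rw [hc_def, mul_assoc]
    gcongr
    exact newtonDeriv_norm_le hr hh hM p a
  let F : Y → Y := fun y => y + S (newtonDeriv ι M p (T y))
  have hF : ∀ a b, F a - F b = (a - b) + S (newtonDeriv ι M p (T (a - b))) := fun a b => by
    simp only [F, map_sub, newtonDeriv_sub hr hh hM]; abel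
  have hF0 : F 0 = 0 := by
    have := hSD (T 0)
    rw [map_zero, norm_zero, mul_zero, norm_le_zero_iff] at this
    simp [F, this]
  have hmono : ∀ a b, ‖a - b‖ ^ 2 ≤ inner ℝ (F a - F b) (a - b) := fun a b => by
    have h1 := newtonDeriv_inner_nonneg hr hh hM p (T (a - b)) (hT (a - b))
    rw [ContinuousLinearMap.adjoint_inner_right] at h1
    rw [hF, inner_add_left, real_inner_self_eq_norm_sq]
    linarith
  have hle := norm_sub_le_of_stronglyMonotone hmono
  have hsurj : Function.Surjective F := by
    refine surjective_of_stronglyMonotone (L := 1 + c * ‖T‖) (fun a b => ?_) hmono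
    rw [hF, add_mul, one_mul, mul_assoc]
    refine (norm_add_le _ _).trans (add_le_add_right ((hSD _).trans ?_) _)
    gcongr
    exact T.le_opNorm _
  have hiff : ∀ δ : Y × V, NewtonSystem ι M S T p δ w ↔
      F δ.1 = w.1 + S (newtonDeriv ι M p w.2) ∧ δ.2 = w.2 - T δ.1 := fun δ => by
    rw [NewtonSystem, ← eq_sub_iff_add_eq, and_congr_left_iff]
    intro h2
    rw [h2, newtonDeriv_sub hr hh hM, map_sub, ← sub_eq_zero, ← sub_eq_zero (a := F δ.1)]
    simp only [F]
    constructor <;> intro h3 <;> rw [← h3] <;> abel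
  obtain ⟨y, hy⟩ := hsurj (w.1 + S (newtonDeriv ι M p w.2))
  refine ⟨(y, w.2 - T y), (hiff _).2 ⟨hy, rfl⟩, fun δ' hδ' => ?_, ?_⟩
  · obtain ⟨h1, h2⟩ := (hiff _).1 hδ'
    have h3 := hle δ'.1 y
    rw [h1, hy, sub_self, norm_zero, norm_le_zero_iff, sub_eq_zero] at h3
    exact Prod.ext h3 (by rw [h2, h3])
  · have h1 := hle y 0
    rw [hF0, hy, sub_zero, sub_zero] at h1
    have h2 := h1.trans ((norm_add_le _ _).trans (add_le_add_right (hSD w.2) _))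
    have h3 : ‖w.2 - T y‖ ≤ ‖w.2‖ + ‖T‖ * ‖y‖ :=
      (norm_sub_le _ _).trans (add_le_add_right (T.le_opNorm y) _)
    have h4 : ‖y‖ ≤ (1 + c) * (‖w.1‖ + ‖w.2‖) := by
      nlinarith [norm_nonneg w.1, norm_nonneg w.2, mul_nonneg hc (norm_nonneg w.1)]
    have h5 : (1 + ‖T‖) * ‖y‖ ≤ (1 + ‖T‖) * ((1 + c) * (‖w.1‖ + ‖w.2‖)) := by gcongr
    show ‖y‖ + ‖w.2 - T y‖ ≤ _
    nlinarith [norm_nonneg w.1]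

lemma existsUnique_newtonStep (hr : 2 < r) (hh : IsMonotoneSemismooth h K)
    (hM : IsClarkeSelection h ι M)
    (hT : ∀ y : Y, ι (T y) =ᵐ[μ] ContinuousLinearMap.adjoint S y) (z : Y) (x : Y × V) :
    ∃! x' : Y × V, IsNewtonStep h ι M S T z x x' := by
  obtain ⟨C, -, hC⟩ := newtonSystem_solvable hr hh hM hT
  obtain ⟨δ, h1, h2, -⟩ := hC x.2 (-x.1 + S (superposition h ι x.2), -x.2 - T (x.1 - z))
  refine ⟨x + δ, ⟨δ, h1, rfl⟩, ?_⟩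
  rintro _ ⟨η, h3, rfl⟩
  rw [h2 η h3]

/-- The new error solves the Newton system with right side $(SR,0)$, where $R$ is the linearization
residual at the old iterate, so it is at most $C\|S\|\|R\|=o(\|p^k-\bar p\|)$. -/
theorem newton_superlinear (hr : 2 < r) (hh : IsMonotoneSemismooth h K)
    (hM : IsClarkeSelection h ι M)
    (hT : ∀ y : Y, ι (T y) =ᵐ[μ] ContinuousLinearMap.adjoint S y) (z : Y) (xs : Y × V)
    (hxs : IsSolution h ι S T z xs) :
    ∃ ε > 0, ∀ x : ℕ → Y × V, x 0 ∈ Metric.ball xs ε →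
      (∀ k, IsNewtonStep h ι M S T z (x k) (x (k + 1))) →
        Tendsto x atTop (𝓝 xs) ∧ (fun k => x (k + 1) - xs) =o[atTop] fun k => x k - xs := by
  obtain ⟨C, hC0, hC⟩ := newtonSystem_solvable hr hh hM hT
  set R : V → Lp Plane 2 μ := fun δ =>
    superposition h ι (xs.2 + δ) - superposition h ι xs.2 - newtonDeriv ι M (xs.2 + δ) δ
  have hR : R =o[𝓝 0] fun δ : V => δ := superposition_newtonDifferentiable hr hh hM xs.2
  have herr : ∀ x x' : Y × V, IsNewtonStep h ι M S T z x x' →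
      ‖x' - xs‖ ≤ C * ‖S‖ * ‖R (x.2 - xs.2)‖ := by
    intro x x' hx
    obtain ⟨δ, -, h2, h3⟩ := hC x.2 (S (superposition h ι x.2 - superposition h ι xs.2
      - newtonDeriv ι M x.2 (x.2 - xs.2)), 0)
    rw [← h2 _ (hx.newtonSystem_error hr hh hM hxs)] at h3
    have h4 : ‖x' - xs‖ ≤ ‖(x' - xs).1‖ + ‖(x' - xs).2‖ :=
      max_le_add_of_nonneg (norm_nonneg _) (norm_nonneg _)
    refine h4.trans (h3.trans ?_)
    simp only [norm_zero, add_zero, R, add_sub_cancel]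
    rw [mul_assoc]
    gcongr
    exact S.le_opNorm _
  have hsnd : ∀ x : Y × V, ‖x.2‖ ≤ ‖x‖ := fun x => le_max_right _ _
  have hRS : (fun δ : V => C * ‖S‖ * ‖R δ‖) =o[𝓝 0] fun δ : V => δ :=
    hR.norm_left.const_mul_left _
  -- Within $\varepsilon$ the error at least halves, which keeps the iterates in the ball and forces
  -- convergence; the rate then follows from the little-o bound along the sequence.
  obtain ⟨ε, hε, hball⟩ := Metric.eventually_nhds_iff.1 (hRS.def (half_pos one_pos))
  refine ⟨ε, hε, fun x hx0 hstep => ?_⟩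
  have hhalf : ∀ k, ‖x k - xs‖ < ε → ‖x (k + 1) - xs‖ ≤ 1 / 2 * ‖x k - xs‖ := fun k hk => by
    have h1 := hball (y := (x k).2 - xs.2) (by
      rw [dist_zero_right]; exact (hsnd (x k - xs)).trans_lt hk)
    rw [Real.norm_of_nonneg (by positivity)] at h1
    refine (herr _ _ (hstep k)).trans (h1.trans ?_)
    gcongr
    exact hsnd (x k - xs)
  have hgeo : ∀ k, ‖x k - xs‖ < ε ∧ ‖x k - xs‖ ≤ (1 / 2) ^ k * ‖x 0 - xs‖ := fun k => by
    induction k with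
    | zero => exact ⟨by rwa [← dist_eq_norm], by simp⟩
    | succ k ih =>
      have h1 := hhalf k ih.1
      refine ⟨h1.trans_lt (by linarith [norm_nonneg (x k - xs), ih.1]), h1.trans ?_⟩
      rw [pow_succ]
      linarith [ih.2]
  have hlim : Tendsto x atTop (𝓝 xs) := by
    rw [tendsto_iff_norm_sub_tendsto_zero]
    refine squeeze_zero (fun _ => norm_nonneg _) (fun k => (hgeo k).2) ?_
    simpa using (tendsto_pow_atTop_nhds_zero_of_lt_one (r := (1 / 2 : ℝ)) (by norm_num)
      (by norm_num)).mul_const ‖x 0 - xs‖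
  refine ⟨hlim, ?_⟩
  have hlim2 : Tendsto (fun k => (x k).2 - xs.2) atTop (𝓝 0) := by
    have := ((continuous_snd.tendsto xs).comp hlim).sub_const xs.2
    simpa using this
  have h1 : (fun k => x (k + 1) - xs) =O[atTop] fun k => C * ‖S‖ * ‖R ((x k).2 - xs.2)‖ :=
    IsBigO.of_bound 1 (Eventually.of_forall fun k => by
      rw [one_mul]
      exact (herr _ _ (hstep k)).trans (le_abs_self _))
  have h2 : (fun k => (x k).2 - xs.2) =O[atTop] fun k => x k - xs :=
    IsBigO.of_bound 1 (Eventually.of_forall fun k => by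
      rw [one_mul]
      exact hsnd (x k - xs))
  exact h1.trans_isLittleO ((hRS.comp_tendsto hlim2).trans_isBigO h2)

end Newton

end SwitchingControl

end

open SwitchingControl in
theorem mainTheorem10 {d : ℕ} (D : Set (EuclideanSpace ℝ (Fin d))) (hD : MeasurableSet D)
    (hDfin : volume D < ∞)
    (α β γ : ℝ) (hα : 0 < α) (hβ : 0 < β) (hγ : 0 < γ)
    (r : ℝ≥0∞) [Fact (1 ≤ r)] (hr : 2 < r)
    {V : Type*} [NormedAddCommGroup V] [NormedSpace ℝ V] [CompleteSpace V]
    (ι : V →L[ℝ] Lp Plane r (volume.restrict D)) (hι : Function.Injective ι)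
    {Y : Type*} [NormedAddCommGroup Y] [InnerProductSpace ℝ Y] [CompleteSpace Y]
    (z : Y) (S : Lp Plane 2 (volume.restrict D) →L[ℝ] Y)
    (T : Y →L[ℝ] V)
    (hT : ∀ y : Y, ⇑(ι (T y)) =ᵐ[volume.restrict D] ⇑(ContinuousLinearMap.adjoint S y))
    (M : V → EuclideanSpace ℝ (Fin d) → (Plane →L[ℝ] Plane))
    (hM : IsClarkeSelection (hReg α β γ) ι M) :
    (∀ p : V, MemLp (fun x => hReg α β γ (ι p x)) 2 (volume.restrict D)) ∧
    (∀ p δp : V, MemLp (fun x => M p x (ι δp x)) 2 (volume.restrict D)) ∧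
    (∀ p : V, (fun δp : V => superposition (hReg α β γ) ι (p + δp)
        - superposition (hReg α β γ) ι p - newtonDeriv ι M (p + δp) δp) =o[𝓝 0]
          fun δp : V => δp) ∧
    (∃ C : ℝ, ∀ (p : V) (w : Y × V), ∃ δ : Y × V, NewtonSystem ι M S T p δ w ∧
        (∀ δ' : Y × V, NewtonSystem ι M S T p δ' w → δ' = δ) ∧
        ‖δ.1‖ + ‖δ.2‖ ≤ C * (‖w.1‖ + ‖w.2‖)) ∧
    (∀ x : Y × V, ∃! x' : Y × V, IsNewtonStep (hReg α β γ) ι M S T z x x') ∧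
    (∃ x : Y × V, IsSolution (hReg α β γ) ι S T z x) ∧
    ∀ xs : Y × V, IsSolution (hReg α β γ) ι S T z xs →
      ∃ ε > 0, ∀ x : ℕ → Y × V, x 0 ∈ Metric.ball xs ε →
        (∀ k, IsNewtonStep (hReg α β γ) ι M S T z (x k) (x (k + 1))) →
          Tendsto x atTop (𝓝 xs) ∧
          (fun k => x (k + 1) - xs) =o[atTop] fun k => x k - xs := by
  have hfin : IsFiniteMeasure (volume.restrict D) := isFiniteMeasure_restrict.2 hDfin.ne
  have hh := isMonotoneSemismooth_hReg hα hβ hγ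
  obtain ⟨C, -, hC⟩ := newtonSystem_solvable hr hh hM hT
  exact ⟨memLp_superposition hr hh, memLp_newtonDeriv hr hh hM,
    superposition_newtonDifferentiable hr hh hM, ⟨C, hC⟩,
    existsUnique_newtonStep hr hh hM hT z, exists_isSolution hr hh hT z,
    newton_superlinear hr hh hM hT z⟩
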